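/- Fix $\beta>0$ and $K>0$. Let $\Lambda=\{-1,0,1\}$, $\rho=\frac13(\delta_{-1}+\delta_0+\delta_1)$, let $P_n$ be the product measure on $\Lambda^n$ with one-dimensional marginals $\rho$, and put $S_n(\omega)=\sum_{j=1}^n\omega_j$ and $$h_{n,K}(\omega)=\frac{\sum_{j=1}^n\omega_j^2}{n}-K\Big(\frac{S_n(\omega)}{n}\Big)^2 .$$ The canonical ensemble of the Blume--Emery--Griffiths model is the probability measure $$P_{n,\beta,K}(d\omega)=\frac{\exp[-n\beta h_{n,K}(\omega)]\,P_n(d\omega)}{\int_{\Lambda^n}\exp[-n\beta h_{n,K}]\,dP_n}.$$ Let $\rho_\beta(dy)=e^{-\beta y^2}\rho(dy)\big/\int_\Lambda e^{-\beta y^2}\rho(dy)$, $c_\beta(t)=\log\int_\Lambda e^{ty}\rho_\beta(dy)$, $J_\beta(z)=\sup_{t\in\mathbb R}\{tz-c_\beta(t)\}$ and $G_{\beta,K}(z)=\beta Kz^2-c_\beta(2\beta Kz)$. The set of canonical equilibrium macrostates is $$\tilde{\mathcal E}_{\beta,K}=\{z\in[-1,1]: z\text{ minimizes }J_\beta(z)-\beta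 Kz^2\text{ over }[-1,1]\}.$$ A minimum point $\tilde z$ of $G_{\beta,K}$ has type $r$, where $r$ is a positive integer, if $G^{(2r)}_{\beta,K}(\tilde z)>0$ and $$G_{\beta,K}(z)=G_{\beta,K}(\tilde z)+\frac{G^{(2r)}_{\beta,K}(\tilde z)(z-\tilde z)^{2r}}{(2r)!}+O\big((z-\tilde z)^{2r+1}\big)\quad\text{as }z\to\tilde z.$$ Set $\beta_c=\log 4$ and $K_c^{(2)}(\beta)=1/(2\beta c_\beta''(0))$. **Theorem.** Suppose that $\tilde{\mathcal E}_{\beta,K}=\{0\}$. Then the point $0$ has exactly one type $r$ as a minimum point of $G_{\beta,K}$, and $r\in\{1,2,3\}$. Moreover $r=2$ if and only if $K=K_c^{(2)}(\beta)$ and $\beta<\beta_c$, and $r=3$ if and only if $K=K_c^{(2)}(\beta)$ and $\beta=\beta_c$. As $n\to\infty$ the following hold. * If $r=1$, then $\sigma^2=2\beta Kc_\beta''(0)/G_{\beta,K}''(0)$ is positive, and the $P_{n,\beta,K}$-distributions of $S_n/n^{1-1/(2r)}=S_n/n^{1/2}$ converge weakly to $N(0,\sigma^2)$. * If $r=2$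 or $r=3$, then the $P_{n,\beta,K}$-distributions of $S_n/n^{1-1/(2r)}$ (that is, of $S_n/n^{3/4}$ or $S_n/n^{5/6}$ respectively) converge weakly to the probability distribution on $\mathbb R$ whose density is proportional to $\exp\!\big(-G_{\beta,K}^{(2r)}(0)\,x^{2r}/(2r)!\big)$. When $r=2$, $$G_{\beta,K}^{(4)}(0)=-(2\beta K)^4c_\beta^{(4)}(0)=-(2\beta K)^4\cdot\frac{2e^{-\beta}(1+2e^{-\beta})(1-2e^{-\beta}-8e^{-2\beta})}{(1+2e^{-\beta})^4},$$ and when $r=3$, $G_{\beta,K}^{(6)}(0)=2(2\beta K)^6/9$. -/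

import Mathlib

open MeasureTheory ProbabilityTheory Filter Topology Set
open scoped ENNReal NNReal Nat

noncomputable section

namespace BEG

/-- The spin space `Λ = {-1, 0, 1}`. -/
abbrev Spin : Type := {s : ℤ // s = -1 ∨ s = 0 ∨ s = 1}

instance instFiniteSpin : Finite Spin :=
  Set.Finite.to_subtype ((Set.finite_Icc (-1 : ℤ) 1).subset (by
    rintro s (rfl | rfl | rfl) <;> simp))

/-- The numerical value of a spin. -/
def val (s : Spin) : ℝ := ((s : ℤ) : ℝ)

/-- The single-site prior `ρ = (δ₋₁ + δ₀ + δ₁) / 3`. -/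
def rho : Measure Spin :=
  (3 : ℝ≥0∞)⁻¹ • (Measure.dirac ⟨-1, by simp⟩ + Measure.dirac ⟨0, by simp⟩ +
    Measure.dirac ⟨1, by simp⟩)

instance instIsProbabilityMeasureRho : IsProbabilityMeasure rho := by
  constructor
  simp only [rho, Measure.smul_apply, Measure.add_apply, measure_univ, smul_eq_mul]
  rw [show (1 + 1 + 1 : ℝ≥0∞) = 3 by norm_num]
  exact ENNReal.inv_mul_cancel (by norm_num) (by norm_num)

/-- The product measure `P_n` on `Λⁿ` with one-dimensional marginals `ρ`. -/
def prior (n : ℕ) : Measure (Fin n → Spin) := Measure.pi fun _ => rho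

instance instIsProbabilityMeasurePrior (n : ℕ) : IsProbabilityMeasure (prior n) := by
  unfold prior; infer_instance

/-- The total spin `S_n(ω) = ∑ ω_j`. -/
def totalSpin {n : ℕ} (ω : Fin n → Spin) : ℝ := ∑ j, val (ω j)

/-- The energy per particle
`h_{n,K}(ω) = (∑ ω_j²) / n - K ((∑ ω_j) / n)²`. -/
def energy (K : ℝ) {n : ℕ} (ω : Fin n → Spin) : ℝ :=
  (∑ j, val (ω j) ^ 2) / n - K * (totalSpin ω / n) ^ 2

/-- The partition function `Z_n(β, K) = ∫ exp(-n β h_{n,K}) dP_n`. -/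
def partitionFunction (β K : ℝ) (n : ℕ) : ℝ :=
  ∫ ω, Real.exp (-(n * β * energy K ω)) ∂prior n

/-- The canonical ensemble `P_{n,β,K}(dω) = Z_n(β, K)⁻¹ exp(-n β h_{n,K}(ω)) P_n(dω)`. -/
def canonical (β K : ℝ) (n : ℕ) : Measure (Fin n → Spin) :=
  (prior n).withDensity fun ω =>
    ENNReal.ofReal (Real.exp (-(n * β * energy K ω)) / partitionFunction β K n)

instance instIsProbabilityMeasureCanonical (β K : ℝ) (n : ℕ) :
    IsProbabilityMeasure (canonical β K n) :=
  isProbabilityMeasure_tilted (f := fun ω => -(n * β * energy K ω)) Integrable.of_finite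

/-- The distribution of `S_n / n ^ a` under the canonical ensemble `P_{n,β,K}`. -/
def scaledSpinLaw (β K a : ℝ) (n : ℕ) : ProbabilityMeasure ℝ :=
  ⟨(canonical β K n).map fun ω => totalSpin ω / (n : ℝ) ^ a,
    Measure.isProbabilityMeasure_map (Measurable.of_discrete).aemeasurable⟩

/-- The normalization `Z(β) = ∫ exp(-β y²) ρ(dy)`. -/
def siteNormalization (β : ℝ) : ℝ := ∫ s, Real.exp (-(β * val s ^ 2)) ∂rho

/-- The single-site measure `ρ_β(dy) = Z(β)⁻¹ exp(-β y²) ρ(dy)`. -/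
def rhoBeta (β : ℝ) : Measure Spin :=
  rho.withDensity fun s => ENNReal.ofReal (Real.exp (-(β * val s ^ 2)) / siteNormalization β)

/-- The cumulant generating function `c_β(t) = log ∫ exp(t y) ρ_β(dy)`. -/
def cumulant (β t : ℝ) : ℝ := Real.log (∫ s, Real.exp (t * val s) ∂rhoBeta β)

theorem cumulant_eq (β t : ℝ) : cumulant β t =
    Real.log ((1 + Real.exp (-β) * (Real.exp t + Real.exp (-t))) / (1 + 2 * Real.exp (-β))) := by
  have hρ : ∀ f : Spin → ℝ, ∫ s, f s ∂rho =
      (f ⟨-1, by simp⟩ + f ⟨0, by simp⟩ + f ⟨1, by simp⟩) / 3 := by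
    intro f
    rw [rho, integral_smul_measure, integral_add_measure Integrable.of_finite Integrable.of_finite,
      integral_add_measure Integrable.of_finite Integrable.of_finite, integral_dirac,
      integral_dirac, integral_dirac]
    simp; ring
  have hd : rhoBeta β = rho.tilted fun s => -(β * val s ^ 2) := rfl
  rw [cumulant, hd, integral_exp_tilted, hρ, hρ]
  congr 1
  simp only [Pi.add_apply, val]
  norm_num [Real.exp_add]
  field_simp
  ring

/-- The Cramér rate function `J_β(z) = sup_t (t z - c_β(t))`. It is used on `[-1, 1]` only,
where the supremum is finite. -/
def rate (β z : ℝ) : ℝ := ⨆ t : ℝ, (t * z - cumulant β t)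

theorem bddAbove_rate (β : ℝ) {z : ℝ} (hz : z ∈ Icc (-1 : ℝ) 1) :
    BddAbove (range fun t : ℝ => t * z - cumulant β t) := by
  refine ⟨-Real.log (Real.exp (-β) / (1 + 2 * Real.exp (-β))), ?_⟩
  rintro _ ⟨t, rfl⟩
  have h1 : t * z ≤ |t| := by
    calc t * z ≤ |t * z| := le_abs_self _
      _ = |t| * |z| := abs_mul _ _
      _ ≤ |t| * 1 := by gcongr; exact abs_le.2 hz
      _ = |t| := mul_one _
  have h2 : |t| + Real.log (Real.exp (-β) / (1 + 2 * Real.exp (-β))) ≤ cumulant β t := by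
    rw [cumulant_eq, ← Real.log_exp |t|, ← Real.log_mul (by positivity) (by positivity)]
    apply Real.log_le_log (by positivity)
    rw [mul_div_assoc']
    gcongr
    have : Real.exp |t| ≤ Real.exp t + Real.exp (-t) := by
      rcases abs_cases t with h | h <;> rw [h.1] <;> linarith [Real.exp_pos t, Real.exp_pos (-t)]
    nlinarith [Real.exp_pos (-β)]
  simp only
  linarith

/-- The set of canonical equilibrium macrostates in terms of the empirical mean `S_n / n`:
the points of `[-1, 1]` that minimize `J_β(z) - β K z²` over `[-1, 1]`. -/
def macrostates (β K : ℝ) : Set ℝ :=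
  {z | z ∈ Icc (-1 : ℝ) 1 ∧ IsMinOn (fun y => rate β y - β * K * y ^ 2) (Icc (-1) 1) z}

/-- The function `G_{β,K}(z) = β K z² - c_β(2 β K z)`. -/
def G (β K z : ℝ) : ℝ := β * K * z ^ 2 - cumulant β (2 * β * K * z)

/-- The minimum point `z` of `g` has type `r`: `r` is a positive integer, `g⁽²ʳ⁾(z) > 0` and
`g(x) = g(z) + g⁽²ʳ⁾(z) (x - z)²ʳ / (2r)! + O((x - z)²ʳ⁺¹)` as `x → z`. -/
def HasMinType (g : ℝ → ℝ) (z : ℝ) (r : ℕ) : Prop :=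
  1 ≤ r ∧ 0 < iteratedDeriv (2 * r) g z ∧
    (fun x => g x - (g z + iteratedDeriv (2 * r) g z * (x - z) ^ (2 * r) / ((2 * r)! : ℝ)))
      =O[𝓝 z] fun x => (x - z) ^ (2 * r + 1)

/-- The variance `σ² = 2 β K c_β''(0) / G_{β,K}''(0)`. -/
def sigmaSq (β K : ℝ) : ℝ :=
  2 * β * K * iteratedDeriv 2 (cumulant β) 0 / iteratedDeriv 2 (G β K) 0

/-- The critical value `β_c = log 4`. -/
def betaCrit : ℝ := Real.log 4

/-- The critical value `K_c⁽²⁾(β) = 1 / (2 β c_β''(0))`. -/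
def KCrit (β : ℝ) : ℝ := 1 / (2 * β * iteratedDeriv 2 (cumulant β) 0)

/-- Weak convergence to a probability distribution with density proportional to `f`. -/
def ConvergesToDensity (μ : ℕ → ProbabilityMeasure ℝ) (f : ℝ → ℝ) : Prop :=
  ∃ ν : ProbabilityMeasure ℝ,
    (∃ C : ℝ, 0 < C ∧
      (ν : Measure ℝ) = (volume : Measure ℝ).withDensity fun x => ENNReal.ofReal (C * f x)) ∧
    Tendsto μ atTop (𝓝 ν)

end BEG

end

/-! The quadratic interaction is linearized by Gaussian smoothing (Hubbard–Stratonovich): `S_n /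
n^a` plus an independent centred Gaussian of variance `1 / (2βK n^(2a-1))` has density proportional
to `exp(-n G(x n^(a-1)))` (`exp_neg_nat_mul_G`). Its characteristic function is a ratio of Laplace
integrals, and dividing by the Gaussian factor gives that of `S_n / n^a`.

For `a = 1 - 1/(2r)` and type `r`, `n G(x n^(-1/(2r)))` tends to `L x^(2r)` with `L =
G⁽²ʳ⁾(0)/(2r)!`. Domination comes from `exists_mul_min_le`, which needs `G > 0` off `0`; convex
duality derives this from uniqueness of the macrostate (`G_pos_of_macrostates`). For `r ≥ 2` the
smoothing variance tends to `0`. For `r = 1` it stays `1/(2βK)` and is subtracted: `1/G''(0) -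
1/(2βK) = σ²`. Convergence of characteristic functions then gives weak convergence.

Since `G` is even with a minimum at `0`, its type is read off the first nonzero even derivative.
`G''(0)` vanishes exactly at `K = K_c⁽²⁾(β)`, `G⁽⁴⁾(0)` has the sign of `4e^(-β) - 1`, and `G⁽⁶⁾(0)
> 0` when `e^(-β) = 1/4`, so `r ≤ 3`. -/

noncomputable section

namespace BEG

/-! ### The single-site cumulant generating function -/

/-- The reciprocal `1 / (1 + 2 e^{-β} cosh t)` of the unnormalized single-site Laplace transform. -/
def invLaplace (β t : ℝ) : ℝ := (1 + 2 * Real.exp (-β) * Real.cosh t)⁻¹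

/-- The tilted single-site mean `c_β'(t)`. -/
def tiltedMean (β t : ℝ) : ℝ := 2 * Real.exp (-β) * Real.sinh t * invLaplace β t

theorem laplace_pos (β t : ℝ) : 0 < 1 + 2 * Real.exp (-β) * Real.cosh t := by
  have := Real.exp_pos (-β)
  have := Real.cosh_pos t
  positivity

theorem cumulant_eq_log_sub_log (β : ℝ) : cumulant β = fun t =>
    Real.log (1 + 2 * Real.exp (-β) * Real.cosh t) - Real.log (1 + 2 * Real.exp (-β)) := by
  ext t
  rw [cumulant_eq, ← Real.log_div (laplace_pos β t).ne' (by positivity), Real.cosh_eq]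
  congr 2
  ring

theorem cumulant_zero (β : ℝ) : cumulant β 0 = 0 := by
  simp [cumulant_eq_log_sub_log]

theorem cumulant_neg (β t : ℝ) : cumulant β (-t) = cumulant β t := by
  simp [cumulant_eq_log_sub_log]

theorem cumulant_nonneg (β t : ℝ) : 0 ≤ cumulant β t := by
  rw [cumulant_eq_log_sub_log, sub_nonneg]
  apply Real.log_le_log (by positivity)
  nlinarith [Real.exp_pos (-β), Real.one_le_cosh t]

theorem cumulant_le_abs (β t : ℝ) : cumulant β t ≤ |t| := by
  rw [cumulant_eq_log_sub_log, sub_le_iff_le_add, ← Real.log_exp |t|,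
    ← Real.log_mul (by positivity) (by positivity)]
  apply Real.log_le_log (laplace_pos β t)
  have h1 : Real.cosh t ≤ Real.exp |t| := by
    rw [← Real.cosh_abs, Real.cosh_eq]
    have : Real.exp (-|t|) ≤ Real.exp |t| := Real.exp_le_exp.2 (by linarith [abs_nonneg t])
    linarith
  nlinarith [Real.exp_pos (-β), Real.add_one_le_exp |t|, abs_nonneg t]

theorem contDiff_cumulant (β : ℝ) {m : WithTop ℕ∞} : ContDiff ℝ m (cumulant β) := by
  rw [cumulant_eq_log_sub_log]
  exact ((contDiff_const.add (contDiff_const.mul Real.contDiff_cosh)).log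
    fun t => (laplace_pos β t).ne').sub contDiff_const

theorem invLaplace_zero (β : ℝ) : invLaplace β 0 = (1 + 2 * Real.exp (-β))⁻¹ := by
  simp [invLaplace]

theorem tiltedMean_zero (β : ℝ) : tiltedMean β 0 = 0 := by simp [tiltedMean]

theorem hasDerivAt_cumulant (β t : ℝ) : HasDerivAt (cumulant β) (tiltedMean β t) t := by
  rw [cumulant_eq_log_sub_log]
  refine (((((Real.hasDerivAt_cosh t).const_mul (2 * Real.exp (-β))).const_add 1).log
    (laplace_pos β t).ne').sub_const _).congr_deriv ?_
  rw [tiltedMean, invLaplace, div_eq_mul_inv]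

theorem hasDerivAt_invLaplace (β t : ℝ) :
    HasDerivAt (invLaplace β) (-(tiltedMean β t * invLaplace β t)) t := by
  refine ((((Real.hasDerivAt_cosh t).const_mul (2 * Real.exp (-β))).const_add 1).inv
    (laplace_pos β t).ne').congr_deriv ?_
  rw [tiltedMean, invLaplace]
  have := (laplace_pos β t).ne'
  field_simp

/-- With `w = invLaplace`, `u = tiltedMean` and `a = e^(-β)`, `cosh² - sinh² = 1` gives `u² = (1 -
w)² - 4a²w²`. Together with `w' = -uw`, this keeps every higher derivative of the cumulant a
polynomial in `u` and `w`, and `u = 0` at the origin. -/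
theorem hasDerivAt_tiltedMean (β t : ℝ) : HasDerivAt (tiltedMean β)
    (invLaplace β t + (4 * Real.exp (-β) ^ 2 - 1) * invLaplace β t ^ 2) t := by
  refine (((Real.hasDerivAt_sinh t).const_mul (2 * Real.exp (-β))).mul
    (hasDerivAt_invLaplace β t)).congr_deriv ?_
  have hw : invLaplace β t * (1 + 2 * Real.exp (-β) * Real.cosh t) = 1 :=
    inv_mul_cancel₀ (laplace_pos β t).ne'
  have hs := Real.cosh_sq t
  rw [tiltedMean]
  generalize invLaplace β t = w at *
  generalize Real.exp (-β) = a at *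
  have hc : 2 * a * Real.cosh t * w = 1 - w := by linarith
  have : (2 * a * Real.sinh t * w) ^ 2 = (1 - w) ^ 2 - 4 * a ^ 2 * w ^ 2 := by
    rw [← hc]
    linear_combination (-4 * a ^ 2 * w ^ 2) * hs
  linear_combination hc - this

theorem iteratedDeriv_one_cumulant (β : ℝ) : iteratedDeriv 1 (cumulant β) = tiltedMean β := by
  rw [iteratedDeriv_one]
  exact funext fun t => (hasDerivAt_cumulant β t).deriv

theorem iteratedDeriv_two_cumulant (β : ℝ) : iteratedDeriv 2 (cumulant β) = fun t =>
    invLaplace β t + (4 * Real.exp (-β) ^ 2 - 1) * invLaplace β t ^ 2 := by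
  rw [iteratedDeriv_succ, iteratedDeriv_one_cumulant]
  exact funext fun t => (hasDerivAt_tiltedMean β t).deriv

theorem iteratedDeriv_three_cumulant (β : ℝ) : iteratedDeriv 3 (cumulant β) = fun t =>
    -(tiltedMean β t *
      (invLaplace β t + 2 * (4 * Real.exp (-β) ^ 2 - 1) * invLaplace β t ^ 2)) := by
  rw [iteratedDeriv_succ, iteratedDeriv_two_cumulant]
  refine funext fun t => HasDerivAt.deriv ?_
  have hw := hasDerivAt_invLaplace β t
  refine (hw.add ((hw.pow 2).const_mul _)).congr_deriv ?_
  ring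

theorem iteratedDeriv_four_cumulant (β : ℝ) : iteratedDeriv 4 (cumulant β) = fun t =>
    -((invLaplace β t + (4 * Real.exp (-β) ^ 2 - 1) * invLaplace β t ^ 2) *
        (invLaplace β t + 2 * (4 * Real.exp (-β) ^ 2 - 1) * invLaplace β t ^ 2)) +
      tiltedMean β t ^ 2 *
        (invLaplace β t + 4 * (4 * Real.exp (-β) ^ 2 - 1) * invLaplace β t ^ 2) := by
  rw [iteratedDeriv_succ, iteratedDeriv_three_cumulant]
  refine funext fun t => HasDerivAt.deriv ?_
  have hw := hasDerivAt_invLaplace β t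
  have hu := hasDerivAt_tiltedMean β t
  refine (hu.mul (hw.add ((hw.pow 2).const_mul _))).neg.congr_deriv ?_
  simp only [Pi.pow_apply, Pi.add_apply]
  ring

theorem iteratedDeriv_five_cumulant (β : ℝ) : iteratedDeriv 5 (cumulant β) = fun t =>
    tiltedMean β t * (4 * invLaplace β t ^ 2 +
        19 * (4 * Real.exp (-β) ^ 2 - 1) * invLaplace β t ^ 3 +
        16 * (4 * Real.exp (-β) ^ 2 - 1) ^ 2 * invLaplace β t ^ 4) -
      tiltedMean β t ^ 3 *
        (invLaplace β t + 8 * (4 * Real.exp (-β) ^ 2 - 1) * invLaplace β t ^ 2) := by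
  rw [iteratedDeriv_succ, iteratedDeriv_four_cumulant]
  refine funext fun t => HasDerivAt.deriv ?_
  have hw := hasDerivAt_invLaplace β t
  have hu := hasDerivAt_tiltedMean β t
  refine (((hw.add ((hw.pow 2).const_mul _)).mul (hw.add ((hw.pow 2).const_mul _))).neg.add
    ((hu.pow 2).mul (hw.add ((hw.pow 2).const_mul _)))).congr_deriv ?_
  simp only [Pi.pow_apply, Pi.add_apply]
  ring

theorem iteratedDeriv_two_cumulant_zero (β : ℝ) :
    iteratedDeriv 2 (cumulant β) 0 = 2 * Real.exp (-β) / (1 + 2 * Real.exp (-β)) := by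
  have : 1 + 2 * Real.exp (-β) ≠ 0 := by positivity
  simp only [iteratedDeriv_two_cumulant, invLaplace_zero]
  field_simp
  ring

theorem iteratedDeriv_two_cumulant_zero_pos (β : ℝ) : 0 < iteratedDeriv 2 (cumulant β) 0 := by
  rw [iteratedDeriv_two_cumulant_zero]
  positivity

theorem iteratedDeriv_four_cumulant_zero (β : ℝ) : iteratedDeriv 4 (cumulant β) 0 =
    2 * Real.exp (-β) * (1 - 4 * Real.exp (-β)) / (1 + 2 * Real.exp (-β)) ^ 2 := by
  have : 1 + 2 * Real.exp (-β) ≠ 0 := by positivity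
  simp only [iteratedDeriv_four_cumulant, invLaplace_zero, tiltedMean_zero]
  field_simp
  ring

theorem iteratedDeriv_six_cumulant_zero (β : ℝ) : iteratedDeriv 6 (cumulant β) 0 =
    (invLaplace β 0 + (4 * Real.exp (-β) ^ 2 - 1) * invLaplace β 0 ^ 2) *
      (4 * invLaplace β 0 ^ 2 +
        19 * (4 * Real.exp (-β) ^ 2 - 1) * invLaplace β 0 ^ 3 +
        16 * (4 * Real.exp (-β) ^ 2 - 1) ^ 2 * invLaplace β 0 ^ 4) := by
  rw [iteratedDeriv_succ, iteratedDeriv_five_cumulant]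
  refine HasDerivAt.deriv ?_
  have hw := hasDerivAt_invLaplace β 0
  have hu := hasDerivAt_tiltedMean β 0
  refine ((hu.mul ((((hw.pow 2).const_mul _).add ((hw.pow 3).const_mul _)).add
    ((hw.pow 4).const_mul _))).sub
    ((hu.pow 3).mul (hw.add ((hw.pow 2).const_mul _)))).congr_deriv ?_
  simp only [Pi.pow_apply, Pi.add_apply, tiltedMean_zero]
  ring

theorem iteratedDeriv_six_cumulant_zero_of_exp {β : ℝ} (h : Real.exp (-β) = 1 / 4) :
    iteratedDeriv 6 (cumulant β) 0 = -(2 / 9) := by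
  rw [iteratedDeriv_six_cumulant_zero, invLaplace_zero, h]
  norm_num

/-- The graph of `c_β` lies above its tangent lines. -/
theorem cumulant_add_tiltedMean_mul_le (β t s : ℝ) :
    cumulant β t + tiltedMean β t * (s - t) ≤ cumulant β s := by
  have hmono : Monotone (tiltedMean β) := by
    refine monotone_of_deriv_nonneg (fun t => (hasDerivAt_tiltedMean β t).differentiableAt) ?_
    intro t
    rw [(hasDerivAt_tiltedMean β t).deriv]
    have hL := laplace_pos β t
    -- The coefficient `4e^(-2β) - 1` may be negative; over the common denominator every term is
    -- positive.
    have h : invLaplace β t + (4 * Real.exp (-β) ^ 2 - 1) * invLaplace β t ^ 2 =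
        (2 * Real.exp (-β) * Real.cosh t + 4 * Real.exp (-β) ^ 2) *
          invLaplace β t ^ 2 := by
      rw [invLaplace]
      field_simp
      ring
    rw [h]
    have := Real.cosh_pos t
    positivity
  have hconv : ConvexOn ℝ univ (cumulant β) := by
    refine Monotone.convexOn_univ_of_deriv
      (fun t => (hasDerivAt_cumulant β t).differentiableAt) ?_
    rwa [← iteratedDeriv_one, iteratedDeriv_one_cumulant]
  rcases lt_trichotomy t s with h | h | h
  · have := hconv.le_slope_of_hasDerivAt (mem_univ t) (mem_univ s) h (hasDerivAt_cumulant β t)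
    rw [slope_def_field, le_div_iff₀ (by linarith)] at this
    linarith
  · simp [h]
  · have := hconv.slope_le_of_hasDerivAt (mem_univ s) (mem_univ t) h (hasDerivAt_cumulant β t)
    rw [slope_def_field, div_le_iff₀ (by linarith)] at this
    linarith

theorem tiltedMean_mem_Icc (β t : ℝ) : tiltedMean β t ∈ Icc (-1 : ℝ) 1 := by
  have h0 := laplace_pos β t
  have h1 := Real.exp_pos (-β)
  have h2 : Real.sinh t ≤ Real.cosh t := (Real.sinh_lt_cosh t).le
  have h3 : -Real.cosh t ≤ Real.sinh t := by
    rw [Real.cosh_eq, Real.sinh_eq]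
    linarith [Real.exp_pos t]
  rw [tiltedMean, invLaplace, ← div_eq_mul_inv]
  constructor
  · rw [le_div_iff₀ h0]; nlinarith
  · rw [div_le_iff₀ h0]; nlinarith

/-! ### The rate function and the free energy functional `G` -/

/-- The tangent line at `t` shows that the Legendre supremum at slope `c_β'(t)` is attained at `t`.
-/
theorem rate_tiltedMean_le (β t : ℝ) :
    rate β (tiltedMean β t) ≤ t * tiltedMean β t - cumulant β t :=
  ciSup_le fun s => by linarith [cumulant_add_tiltedMean_mul_le β t s]

theorem rate_zero (β : ℝ) : rate β 0 = 0 := by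
  apply le_antisymm
  · exact ciSup_le fun s => by linarith [cumulant_nonneg β s]
  · have := le_ciSup (bddAbove_rate β (z := 0) (by simp)) 0
    simpa [rate, cumulant_zero] using this

theorem G_zero (β K : ℝ) : G β K 0 = 0 := by simp [G, cumulant_zero]

theorem G_neg (β K z : ℝ) : G β K (-z) = G β K z := by
  simp [G, cumulant_neg]

theorem contDiff_G (β K : ℝ) {m : WithTop ℕ∞} : ContDiff ℝ m (G β K) :=
  (contDiff_const.mul (contDiff_id.pow 2)).sub
    ((contDiff_cumulant β).comp (contDiff_const.mul contDiff_id))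

/-- If `0` is the only equilibrium macrostate, then it is the only minimum point of `G`. -/
theorem G_pos_of_macrostates {β K : ℝ} (hβ : 0 < β) (hK : 0 < K) (hE : macrostates β K = {0})
    {z : ℝ} (hz : z ≠ 0) : 0 < G β K z := by
  have h0 : (0 : ℝ) ∈ macrostates β K := by simp [hE]
  -- The minimum value is `J_β(0) = 0`, so any other `y` violating this would be a second
  -- macrostate.
  have hJ : ∀ y ∈ Icc (-1 : ℝ) 1, y ≠ 0 → β * K * y ^ 2 < rate β y := by
    intro y hy hy0
    by_contra! hle
    have : y ∈ macrostates β K := by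
      refine ⟨hy, fun x hx => ?_⟩
      have := h0.2 hx
      simp only [mem_ofPred_eq, rate_zero] at this ⊢
      linarith
    rw [hE] at this
    exact hy0 this
  have hβK : 0 < β * K := mul_pos hβ hK
  -- With `y = c_β'(2βKz)` this yields `G(z) ≥ βK(z - y)² + (J_β(y) - βKy²)`. The bracket is
  -- positive if `y ≠ 0`; otherwise the square is.
  have h1 := rate_tiltedMean_le β (2 * β * K * z)
  have h2 := hJ _ (tiltedMean_mem_Icc β (2 * β * K * z))
  generalize tiltedMean β (2 * β * K * z) = y at h1 h2
  rw [G]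
  by_cases hy : y = 0
  · subst hy
    rw [rate_zero] at h1
    nlinarith [mul_pos hβK (sq_pos_of_ne_zero hz)]
  · nlinarith [mul_nonneg hβK.le (sq_nonneg (z - y)), h2 hy]

/-- From `c_β(t) ≤ |t|`, `G(z) ≥ βK(z² - 2|z|)`, and `2|z| ≤ z²/2` once `|z| ≥ 4`. -/
theorem G_ge_of_abs_ge {β K : ℝ} (hβ : 0 < β) (hK : 0 < K) {z : ℝ} (hz : 4 ≤ |z|) :
    β * K / 2 * z ^ 2 ≤ G β K z := by
  have h1 := cumulant_le_abs β (2 * β * K * z)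
  rw [abs_mul, abs_of_pos (by positivity)] at h1
  have hβK : 0 < β * K := mul_pos hβ hK
  rw [G]
  nlinarith [mul_nonneg hβK.le (mul_nonneg (abs_nonneg z) (sub_nonneg.2 hz)), sq_abs z]

theorem iteratedDeriv_two_G_zero (β K : ℝ) : iteratedDeriv 2 (G β K) 0 =
    2 * β * K * (1 - 2 * β * K * iteratedDeriv 2 (cumulant β) 0) := by
  have h1 : ContDiffAt ℝ (2 : ℕ) (fun z : ℝ => β * K * z ^ 2) 0 := by fun_prop
  have h2 : ContDiff ℝ (2 : ℕ) (fun z : ℝ => cumulant β (2 * β * K * z)) :=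
    (contDiff_cumulant β).comp (contDiff_const.mul contDiff_id)
  have h3 : G β K = (fun z : ℝ => β * K * z ^ 2) - fun z => cumulant β (2 * β * K * z) := rfl
  rw [h3, iteratedDeriv_sub h1 h2.contDiffAt,
    iteratedDeriv_comp_const_mul (contDiff_cumulant β), iteratedDeriv_const_mul_field,
    iteratedDeriv_fun_pow_zero]
  simp
  ring

theorem iteratedDeriv_G_zero (β K : ℝ) {k : ℕ} (hk : k ≠ 2) : iteratedDeriv k (G β K) 0 =
    -((2 * β * K) ^ k * iteratedDeriv k (cumulant β) 0) := by
  have h1 : ContDiffAt ℝ k (fun z : ℝ => β * K * z ^ 2) 0 := by fun_prop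
  have h2 : ContDiff ℝ k (fun z : ℝ => cumulant β (2 * β * K * z)) :=
    (contDiff_cumulant β).comp (contDiff_const.mul contDiff_id)
  have h3 : G β K = (fun z : ℝ => β * K * z ^ 2) - fun z => cumulant β (2 * β * K * z) := rfl
  rw [h3, iteratedDeriv_sub h1 h2.contDiffAt,
    iteratedDeriv_comp_const_mul (contDiff_cumulant β), iteratedDeriv_const_mul_field,
    iteratedDeriv_fun_pow_zero]
  simp [hk]

/-! ### Taylor expansions of even functions and types of minimum points -/

theorem iteratedDeriv_odd_eq_zero {f : ℝ → ℝ} (hf : ∀ x, f (-x) = f x) {k : ℕ} (hk : Odd k) :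
    iteratedDeriv k f 0 = 0 := by
  have h := iteratedDeriv_comp_neg k f 0
  simp only [hf, hk.neg_one_pow, neg_zero, neg_smul, one_smul] at h
  linarith

theorem isBigO_sub_taylor_of_even {f : ℝ → ℝ} (hf : ∀ x, f (-x) = f x) {r : ℕ} (hr : 1 ≤ r)
    (hd : ContDiff ℝ (2 * r + 1 : ℕ) f) (h0 : ∀ j, 1 ≤ j → j < r → iteratedDeriv (2 * j) f 0 = 0) :
    (fun x => f x - (f 0 + iteratedDeriv (2 * r) f 0 * (x - 0) ^ (2 * r) / ((2 * r)! : ℝ)))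
      =O[𝓝 0] fun x => (x - 0) ^ (2 * r + 1) := by
  -- The expansion is taken to degree `2r + 1`: the extra odd term vanishes by evenness, and the
  -- error has the order required.
  refine (taylor_isLittleO_univ (x₀ := 0) hd).isBigO.congr_left fun x => ?_
  rw [taylor_within_apply, Finset.sum_eq_add_of_mem 0 (2 * r) (by simp)
    (by rw [Finset.mem_range]; omega) (by omega)]
  · simp [iteratedDerivWithin_univ]
    ring
  · rintro k hk ⟨hk0, hkr⟩
    rw [Finset.mem_range] at hk
    rw [iteratedDerivWithin_univ]
    rcases Nat.even_or_odd' k with ⟨j, rfl | rfl⟩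
    · rw [h0 j (by omega) (by omega), smul_zero]
    · rw [iteratedDeriv_odd_eq_zero hf ⟨j, rfl⟩, smul_zero]

theorem tendsto_div_pow_of_isBigO {f : ℝ → ℝ} {m : ℕ} {y d : ℝ}
    (h : (fun x => f x - (y + d * (x - 0) ^ m / (m ! : ℝ))) =O[𝓝 0]
      fun x => (x - 0) ^ (m + 1)) :
    Tendsto (fun x => (f x - y) / x ^ m) (𝓝[≠] 0) (𝓝 (d / (m ! : ℝ))) := by
  have h1 : (fun x => (f x - y) / x ^ m - d / (m ! : ℝ)) =O[𝓝[≠] 0] fun x => x := by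
    refine ((h.mono nhdsWithin_le_nhds).mul (Asymptotics.isBigO_refl
      (fun x : ℝ => (x ^ m)⁻¹) (𝓝[≠] 0))).congr' ?_ ?_
    · filter_upwards [self_mem_nhdsWithin] with x hx
      have hx : x ≠ 0 := hx
      field_simp
      ring
    · filter_upwards [self_mem_nhdsWithin] with x hx
      have hx : x ≠ 0 := hx
      rw [sub_zero, pow_succ]
      field_simp
  have h2 : Tendsto (fun x : ℝ => x) (𝓝[≠] 0) (𝓝 0) := nhdsWithin_le_nhds
  simpa using (h1.trans_tendsto h2).add_const (d / (m ! : ℝ))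

theorem HasMinType.tendsto_div_pow {g : ℝ → ℝ} {r : ℕ} (h : HasMinType g 0 r) :
    Tendsto (fun x => (g x - g 0) / x ^ (2 * r)) (𝓝[≠] 0)
      (𝓝 (iteratedDeriv (2 * r) g 0 / ((2 * r)! : ℝ))) :=
  tendsto_div_pow_of_isBigO h.2.2

/-- If `r < s`, then `(g x - g 0) / x^(2r)` would tend both to a positive limit and to `0`. Used
both ways, this makes the type unique. -/
theorem HasMinType.le {g : ℝ → ℝ} {r s : ℕ} (hr : HasMinType g 0 r) (hs : HasMinType g 0 s) :
    s ≤ r := by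
  by_contra! hlt
  have h1 : Tendsto (fun x : ℝ => x ^ (2 * s - 2 * r)) (𝓝[≠] 0) (𝓝 0) := by
    have : ContinuousAt (fun x : ℝ => x ^ (2 * s - 2 * r)) 0 := by fun_prop
    rw [ContinuousAt, zero_pow (by omega)] at this
    exact this.mono_left nhdsWithin_le_nhds
  have h2 := hs.tendsto_div_pow.mul h1
  rw [mul_zero] at h2
  have h3 : Tendsto (fun x => (g x - g 0) / x ^ (2 * r)) (𝓝[≠] 0) (𝓝 0) := by
    refine h2.congr' ?_
    filter_upwards [self_mem_nhdsWithin] with x hx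
    have hx : x ≠ 0 := hx
    rw [show x ^ (2 * s) = x ^ (2 * s - 2 * r) * x ^ (2 * r) by rw [← pow_add]; congr 1; omega]
    field_simp
  have h4 := tendsto_nhds_unique hr.tendsto_div_pow h3
  have h5 : 0 < iteratedDeriv (2 * r) g 0 / ((2 * r)! : ℝ) := div_pos hr.2.1 (by positivity)
  exact h5.ne' h4

theorem iteratedDeriv_nonneg_of_even_of_min {f : ℝ → ℝ} (hf : ∀ x, f (-x) = f x) {r : ℕ}
    (hr : 1 ≤ r) (hd : ContDiff ℝ (2 * r + 1 : ℕ) f)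
    (h0 : ∀ j, 1 ≤ j → j < r → iteratedDeriv (2 * j) f 0 = 0) (hmin : ∀ x, f 0 ≤ f x) :
    0 ≤ iteratedDeriv (2 * r) f 0 := by
  have h1 := tendsto_div_pow_of_isBigO (isBigO_sub_taylor_of_even hf hr hd h0)
  have h2 : 0 ≤ iteratedDeriv (2 * r) f 0 / ((2 * r)! : ℝ) :=
    ge_of_tendsto' h1 fun x => div_nonneg (sub_nonneg.2 (hmin x)) ((even_two_mul r).pow_nonneg x)
  have h3 : (0 : ℝ) < ((2 * r)! : ℝ) := by positivity
  rwa [le_div_iff₀ h3, zero_mul] at h2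

/-- A continuous function with a unique minimum point of order `x²ʳ` at `0` and quadratic growth
at infinity is bounded below by a multiple of `min (x²ʳ) (x²)`. -/
theorem exists_mul_min_le {f : ℝ → ℝ} {m : ℕ} {L κ R : ℝ} (hc : Continuous f) (h0 : f 0 = 0)
    (hm : m ≠ 0) (hpos : ∀ x, x ≠ 0 → 0 < f x) (hL : 0 < L)
    (hlim : Tendsto (fun x => f x / x ^ m) (𝓝[≠] 0) (𝓝 L)) (heven : Even m)
    (hκ : 0 < κ) (hgrow : ∀ x, R ≤ |x| → κ * x ^ 2 ≤ f x) :
    ∃ δ, 0 < δ ∧ ∀ x, δ * min (x ^ m) (x ^ 2) ≤ f x := by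
  have h1 : ∀ᶠ x in 𝓝[≠] (0 : ℝ), L / 2 < f x / x ^ m := hlim.eventually_const_lt (by linarith)
  rw [eventually_nhdsWithin_iff, Metric.eventually_nhds_iff] at h1
  obtain ⟨ε, hε, h1⟩ := h1
  -- Between the region near `0` and the region of quadratic growth lies a compact set, possibly
  -- empty, where `f` has a positive minimum.
  obtain ⟨q, hq, h2⟩ : ∃ q, 0 < q ∧ ∀ x, ε ≤ |x| → |x| ≤ R → q * x ^ 2 ≤ f x := by
    have hK : IsCompact {x : ℝ | ε ≤ |x| ∧ |x| ≤ R} := by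
      refine (isCompact_Icc (a := -R) (b := R)).of_isClosed_subset ?_ fun x hx => abs_le.1 hx.2
      exact (isClosed_le continuous_const continuous_abs).inter
        (isClosed_le continuous_abs continuous_const)
    rcases {x : ℝ | ε ≤ |x| ∧ |x| ≤ R}.eq_empty_or_nonempty with he | hne
    · refine ⟨1, one_pos, fun x hx hx' => ?_⟩
      have : x ∈ {x : ℝ | ε ≤ |x| ∧ |x| ≤ R} := ⟨hx, hx'⟩
      simp [he] at this
    · obtain ⟨y, hy, hmin⟩ := hK.exists_isMinOn hne hc.continuousOn
      have hy0 : y ≠ 0 := abs_pos.1 (hε.trans_le hy.1)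
      have hR : 0 < R := hε.trans_le (hy.1.trans hy.2)
      have hfy := hpos y hy0
      refine ⟨f y / R ^ 2, by positivity, fun x hx hx' => ?_⟩
      refine le_trans ?_ (hmin (show x ∈ {x : ℝ | ε ≤ |x| ∧ |x| ≤ R} from ⟨hx, hx'⟩))
      rw [div_mul_eq_mul_div, div_le_iff₀ (by positivity)]
      have : x ^ 2 ≤ R ^ 2 := by rw [← sq_abs x]; gcongr
      gcongr
  refine ⟨min (L / 2) (min q κ), by positivity, fun x => ?_⟩
  have hxm : 0 ≤ x ^ m := heven.pow_nonneg x
  have hmn : 0 ≤ min (x ^ m) (x ^ 2) := le_min hxm (sq_nonneg x)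
  by_cases hx : x = 0
  · simp [hx, h0, hm]
  rcases lt_or_ge |x| ε with hxε | hxε
  · have h3 := h1 (by simpa using hxε) hx
    rw [lt_div_iff₀ (hxm.lt_of_ne' (pow_ne_zero m hx))] at h3
    refine le_trans ?_ h3.le
    gcongr
    · exact min_le_left _ _
    · exact min_le_left _ _
  rcases le_total |x| R with hxR | hxR
  · refine le_trans ?_ (h2 x hxε hxR)
    gcongr
    · exact (min_le_right _ _).trans (min_le_left _ _)
    · exact min_le_right _ _
  · refine le_trans ?_ (hgrow x hxR)
    gcongr
    · exact (min_le_right _ _).trans (min_le_right _ _)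
    · exact min_le_right _ _

/-! ### Gaussian smoothing of the law of the total spin -/

theorem siteNormalization_pos (β : ℝ) : 0 < siteNormalization β :=
  integral_exp_pos Integrable.of_finite

theorem partitionFunction_pos (β K : ℝ) (n : ℕ) : 0 < partitionFunction β K n :=
  integral_exp_pos Integrable.of_finite

theorem exp_cumulant (β t : ℝ) : Real.exp (cumulant β t) =
    (∫ s, Real.exp (t * val s - β * val s ^ 2) ∂rho) / siteNormalization β := by
  have hd : rhoBeta β = rho.tilted fun s => -(β * val s ^ 2) := rfl
  have hp : IsProbabilityMeasure (rhoBeta β) := by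
    rw [hd]
    exact isProbabilityMeasure_tilted Integrable.of_finite
  rw [cumulant, Real.exp_log (integral_exp_pos Integrable.of_finite), hd, integral_exp_tilted]
  congr 1
  refine integral_congr_ae (.of_forall fun s => ?_)
  simp only [Pi.add_apply]
  ring_nf

theorem exp_nat_mul_cumulant (β t : ℝ) (n : ℕ) : Real.exp (n * cumulant β t) =
    (∫ ω, Real.exp (t * totalSpin ω - β * ∑ j, val (ω j) ^ 2) ∂prior n) /
      siteNormalization β ^ n := by
  have h := integral_fintype_prod_eq_pow (ι := Fin n) (μ := rho)
    fun s => Real.exp (t * val s - β * val s ^ 2)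
  rw [Fintype.card_fin] at h
  rw [Real.exp_nat_mul, exp_cumulant, div_pow, ← h]
  congr 1
  refine integral_congr_ae (.of_forall fun ω => ?_)
  simp only [← Real.exp_sum, Finset.sum_sub_distrib, totalSpin, Finset.mul_sum]

theorem integral_canonical (β K : ℝ) (n : ℕ) (f : (Fin n → Spin) → ℝ) :
    ∫ ω, f ω ∂canonical β K n =
      (∫ ω, Real.exp (-(n * β * energy K ω)) * f ω ∂prior n) / partitionFunction β K n := by
  have hd : canonical β K n = (prior n).tilted fun ω => -(n * β * energy K ω) := rfl
  rw [hd, integral_tilted, ← integral_div]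
  refine integral_congr_ae (.of_forall fun ω => ?_)
  simp only [partitionFunction, smul_eq_mul]
  ring

/-- The function `exp(-n G)` is, up to a constant factor, the density of the sum of the rescaled
total spin and an independent Gaussian variable. -/
theorem exp_neg_nat_mul_G (β K a : ℝ) {n : ℕ} (hn : n ≠ 0) (x : ℝ) :
    Real.exp (-(n * G β K (x * (n : ℝ) ^ (a - 1)))) =
      partitionFunction β K n / siteNormalization β ^ n *
        ∫ ω, Real.exp (-(β * K * (n : ℝ) ^ (2 * a - 1)) * (x - totalSpin ω / (n : ℝ) ^ a) ^ 2)
          ∂canonical β K n := by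
  have hn0 : (0 : ℝ) < n := by positivity
  have hZ := (partitionFunction_pos β K n).ne'
  have hs := (siteNormalization_pos β).ne'
  rw [integral_canonical, G, mul_sub, neg_sub, sub_eq_add_neg, Real.exp_add, exp_nat_mul_cumulant]
  field_simp
  rw [← integral_mul_const]
  refine integral_congr_ae (.of_forall fun ω => ?_)
  simp only [← Real.exp_add, energy]
  -- Expanding the square, the cross term is the linear tilt `2βK x n^(a-1) S_n`, and `-βK S_n²/n`
  -- cancels the interaction in the energy.
  congr 1
  have h1 : (n : ℝ) ^ (a - 1) = (n : ℝ) ^ a / n := by rw [Real.rpow_sub_one hn0.ne']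
  have h2 : (n : ℝ) ^ (2 * a - 1) = ((n : ℝ) ^ a) ^ 2 / n := by
    rw [Real.rpow_sub_one hn0.ne', mul_comm, Real.rpow_mul hn0.le, Real.rpow_two]
  have h3 : (n : ℝ) ^ a ≠ 0 := (Real.rpow_pos_of_pos hn0 a).ne'
  rw [h1, h2]
  generalize (n : ℝ) ^ a = q at *
  field_simp
  ring

theorem cexp_mul_exp_neg_sq (b s y x : ℝ) :
    Complex.exp (s * x * Complex.I) * (Real.exp (-b * (x - y) ^ 2) : ℝ) =
      Complex.exp (-b * x ^ 2 + (s * Complex.I + 2 * b * y) * x + -b * y ^ 2) := by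
  rw [Complex.ofReal_exp, ← Complex.exp_add]
  congr 1
  push_cast
  ring

theorem integrable_cexp_mul_exp_neg_sq {b : ℝ} (hb : 0 < b) (s y : ℝ) :
    Integrable fun x : ℝ =>
      Complex.exp (s * x * Complex.I) * (Real.exp (-b * (x - y) ^ 2) : ℝ) := by
  simp only [cexp_mul_exp_neg_sq]
  exact integrable_cexp_quadratic' (by simpa using hb) _ _

theorem integral_cexp_mul_exp_neg_sq {b : ℝ} (hb : 0 < b) (s y : ℝ) :
    ∫ x : ℝ, Complex.exp (s * x * Complex.I) * (Real.exp (-b * (x - y) ^ 2) : ℝ) =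
      (Real.pi / b : ℂ) ^ (1 / 2 : ℂ) *
        (Complex.exp (s * y * Complex.I) * Complex.exp (-s ^ 2 / (4 * b))) := by
  simp only [cexp_mul_exp_neg_sq]
  rw [integral_cexp_quadratic (by simpa using hb), neg_neg, ← Complex.exp_add]
  congr 2
  have : (b : ℂ) ≠ 0 := by exact_mod_cast hb.ne'
  field_simp
  linear_combination (s ^ 2 : ℂ) * Complex.I_sq

theorem charFun_scaledSpinLaw (β K a : ℝ) (n : ℕ) (s : ℝ) :
    charFun (scaledSpinLaw β K a n : Measure ℝ) s =
      ∫ ω, Complex.exp (s * (totalSpin ω / (n : ℝ) ^ a : ℝ) * Complex.I) ∂canonical β K n := by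
  rw [charFun_apply_real]
  exact integral_map Measurable.of_discrete.aemeasurable (by fun_prop)

theorem integral_cexp_mul_exp_neg_G_eq_const_mul {β K : ℝ} (hβ : 0 < β) (hK : 0 < K) (a : ℝ)
    {n : ℕ} (hn : n ≠ 0) (s : ℝ) :
    ∫ x : ℝ, Complex.exp (s * x * Complex.I) *
        (Real.exp (-(n * G β K (x * (n : ℝ) ^ (a - 1)))) : ℝ) =
      (partitionFunction β K n / siteNormalization β ^ n : ℝ) *
        (Real.pi / (β * K * (n : ℝ) ^ (2 * a - 1) : ℝ) : ℂ) ^ (1 / 2 : ℂ) *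
        (charFun (scaledSpinLaw β K a n : Measure ℝ) s *
          Complex.exp (-s ^ 2 / (4 * (β * K * (n : ℝ) ^ (2 * a - 1) : ℝ)))) := by
  have hn0 : (0 : ℝ) < n := by positivity
  have hb : 0 < β * K * (n : ℝ) ^ (2 * a - 1) := by positivity
  rw [charFun_scaledSpinLaw]
  simp only [exp_neg_nat_mul_G β K a hn]
  generalize β * K * (n : ℝ) ^ (2 * a - 1) = b at *
  generalize partitionFunction β K n / siteNormalization β ^ n = A
  cases nonempty_fintype (Fin n → Spin)
  rw [integral_fintype (μ := canonical β K n) Integrable.of_finite]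
  simp only [integral_fintype (μ := canonical β K n) Integrable.of_finite]
  have h : ∀ x : ℝ, Complex.exp (s * x * Complex.I) *
      ((A * ∑ ω : Fin n → Spin, (canonical β K n).real {ω} •
        Real.exp (-b * (x - totalSpin ω / (n : ℝ) ^ a) ^ 2) : ℝ) : ℂ) =
      ∑ ω : Fin n → Spin, (A * (canonical β K n).real {ω} : ℂ) *
        (Complex.exp (s * x * Complex.I) *
          (Real.exp (-b * (x - totalSpin ω / (n : ℝ) ^ a) ^ 2) : ℝ)) := by
    intro x
    simp only [smul_eq_mul, Complex.ofReal_mul, Complex.ofReal_sum, Finset.mul_sum]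
    exact Finset.sum_congr rfl fun ω _ => by ring
  simp only [h]
  rw [integral_finsetSum _ fun ω _ => (integrable_cexp_mul_exp_neg_sq hb _ _).const_mul _]
  simp only [integral_const_mul, integral_cexp_mul_exp_neg_sq hb]
  rw [Finset.sum_mul, Finset.mul_sum]
  refine Finset.sum_congr rfl fun ω _ => ?_
  rw [Complex.real_smul]
  ring

/-- The case `s = 0` identifies the prefactor as the total integral, so no partition function has to
be estimated. -/
theorem integral_cexp_mul_exp_neg_G {β K : ℝ} (hβ : 0 < β) (hK : 0 < K) (a : ℝ) {n : ℕ}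
    (hn : n ≠ 0) (s : ℝ) :
    ∫ x : ℝ, Complex.exp (s * x * Complex.I) *
        (Real.exp (-(n * G β K (x * (n : ℝ) ^ (a - 1)))) : ℝ) =
      ((∫ x : ℝ, Real.exp (-(n * G β K (x * (n : ℝ) ^ (a - 1)))) : ℝ) : ℂ) *
        (charFun (scaledSpinLaw β K a n : Measure ℝ) s *
          Complex.exp (-s ^ 2 / (4 * (β * K * (n : ℝ) ^ (2 * a - 1) : ℝ)))) := by
  have h := integral_cexp_mul_exp_neg_G_eq_const_mul hβ hK a hn 0
  simp only [Complex.ofReal_zero, zero_mul, Complex.exp_zero, one_mul, charFun_zero,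
    probReal_univ, Complex.ofReal_one, ne_eq, OfNat.ofNat_ne_zero, not_false_eq_true, zero_pow,
    neg_zero, zero_div, mul_one] at h
  rw [integral_cexp_mul_exp_neg_G_eq_const_mul hβ hK a hn s, ← integral_complex_ofReal, h]

/-! ### Laplace asymptotics and convergence of characteristic functions -/

theorem integrable_exp_neg_mul_sq_sub_one {δ : ℝ} (hδ : 0 < δ) :
    Integrable fun x : ℝ => Real.exp (-(δ * (x ^ 2 - 1))) := by
  have : (fun x : ℝ => Real.exp (-(δ * (x ^ 2 - 1)))) =
      fun x => Real.exp δ * Real.exp (-δ * x ^ 2) := by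
    ext x
    rw [← Real.exp_add]
    ring_nf
  rw [this]
  exact (integrable_exp_neg_mul_sq hδ).const_mul _

theorem sq_sub_one_le_pow_two_mul {r : ℕ} (hr : 1 ≤ r) (x : ℝ) : x ^ 2 - 1 ≤ x ^ (2 * r) := by
  rw [pow_mul]
  rcases le_total 1 (x ^ 2) with h | h
  · linarith [le_self_pow₀ h (by omega : r ≠ 0)]
  · linarith [pow_nonneg (sq_nonneg x) r]

theorem integrable_exp_neg_mul_pow {L : ℝ} (hL : 0 < L) {r : ℕ} (hr : 1 ≤ r) :
    Integrable fun x : ℝ => Real.exp (-(L * x ^ (2 * r))) := by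
  refine (integrable_exp_neg_mul_sq_sub_one hL).mono' (by fun_prop) (.of_forall fun x => ?_)
  rw [Real.norm_eq_abs, Real.abs_exp]
  gcongr
  exact sq_sub_one_le_pow_two_mul hr x

/-- Laplace asymptotics for `∫ e^{isx} exp(-n f(x / n^{1/(2r)})) dx`. -/
theorem tendsto_integral_cexp_mul_exp_neg {f : ℝ → ℝ} {r : ℕ} {L δ : ℝ} (hc : Continuous f)
    (h0 : f 0 = 0) (hr : 1 ≤ r) (hδ : 0 < δ)
    (hbound : ∀ x, δ * min (x ^ (2 * r)) (x ^ 2) ≤ f x)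
    (hlim : Tendsto (fun x => f x / x ^ (2 * r)) (𝓝[≠] 0) (𝓝 L)) (s : ℝ) :
    Tendsto (fun n : ℕ => ∫ x : ℝ, Complex.exp (s * x * Complex.I) *
        (Real.exp (-(n * f (x * (n : ℝ) ^ (-(1 / (2 * (r : ℝ))))))) : ℝ)) atTop
      (𝓝 (∫ x : ℝ, Complex.exp (s * x * Complex.I) * (Real.exp (-(L * x ^ (2 * r))) : ℝ))) := by
  have hr0 : (1 : ℝ) ≤ r := by exact_mod_cast hr
  have hscale : ∀ n : ℕ, n ≠ 0 → ∀ x : ℝ,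
      n * (x * (n : ℝ) ^ (-(1 / (2 * (r : ℝ))))) ^ (2 * r) = x ^ (2 * r) := by
    intro n hn x
    have hn0 : (0 : ℝ) < n := by positivity
    rw [mul_pow, ← Real.rpow_mul_natCast hn0.le]
    have : -(1 / (2 * (r : ℝ))) * ((2 * r : ℕ) : ℝ) = -1 := by
      push_cast
      field_simp
    rw [this, Real.rpow_neg_one]
    field_simp
  refine tendsto_integral_filter_of_dominated_convergence
    (fun x => Real.exp (-(δ * (x ^ 2 - 1)))) ?_ ?_ (integrable_exp_neg_mul_sq_sub_one hδ) ?_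
  · exact .of_forall fun n => by
      have : Continuous fun x : ℝ => Complex.exp (s * x * Complex.I) *
        (Real.exp (-(n * f (x * (n : ℝ) ^ (-(1 / (2 * (r : ℝ))))))) : ℝ) := by fun_prop
      exact this.aestronglyMeasurable
  · filter_upwards [eventually_ne_atTop 0] with n hn
    refine .of_forall fun x => ?_
    have hn0 : (0 : ℝ) < n := by positivity
    have hn1 : (1 : ℝ) ≤ n := by exact_mod_cast Nat.one_le_iff_ne_zero.2 hn
    rw [norm_mul, ← Complex.ofReal_mul, Complex.norm_exp_ofReal_mul_I, one_mul, Complex.norm_real,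
      Real.norm_eq_abs, Real.abs_exp]
    refine Real.exp_le_exp.2 (neg_le_neg ?_)
    set z := x * (n : ℝ) ^ (-(1 / (2 * (r : ℝ)))) with hz
    -- Here `n z^(2r) = x^(2r)` and `n z² = n^(1-1/r) x² ≥ x²`, so one Gaussian bound serves all `n
    -- ≥ 1`.
    have h1 : x ^ 2 - 1 ≤ n * min (z ^ (2 * r)) (z ^ 2) := by
      rw [mul_min_of_nonneg _ _ hn0.le, le_min_iff, hscale n hn]
      refine ⟨sq_sub_one_le_pow_two_mul hr x, ?_⟩
      have h2 : (1 : ℝ) ≤ n * ((n : ℝ) ^ (-(1 / (2 * (r : ℝ))))) ^ 2 := by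
        rw [← Real.rpow_mul_natCast hn0.le]
        nth_rewrite 1 [← Real.rpow_one (n : ℝ)]
        rw [← Real.rpow_add hn0]
        apply Real.one_le_rpow hn1
        push_cast
        have : 1 / (2 * (r : ℝ)) * 2 ≤ 1 := by
          rw [div_mul_eq_mul_div, div_le_one (by positivity)]
          linarith
        linarith
      rw [hz, mul_pow]
      nlinarith [sq_nonneg x, mul_le_mul_of_nonneg_left h2 (sq_nonneg x)]
    calc δ * (x ^ 2 - 1) ≤ δ * (n * min (z ^ (2 * r)) (z ^ 2)) := by gcongr
      _ = n * (δ * min (z ^ (2 * r)) (z ^ 2)) := by ring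
      _ ≤ n * f z := by gcongr; exact hbound z
  · refine .of_forall fun x => ?_
    have key : Tendsto (fun n : ℕ => n * f (x * (n : ℝ) ^ (-(1 / (2 * (r : ℝ)))))) atTop
        (𝓝 (L * x ^ (2 * r))) := by
      by_cases hx : x = 0
      · have : 2 * r ≠ 0 := by omega
        simp [hx, h0, this]
      have h1 : Tendsto (fun n : ℕ => x * (n : ℝ) ^ (-(1 / (2 * (r : ℝ))))) atTop (𝓝[≠] 0) := by
        refine tendsto_nhdsWithin_iff.2 ⟨?_, ?_⟩
        · have := ((tendsto_rpow_neg_atTop (y := 1 / (2 * (r : ℝ))) (by positivity)).comp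
            tendsto_natCast_atTop_atTop).const_mul x
          simpa using this
        · filter_upwards [eventually_ne_atTop 0] with n hn
          have hn0 : (0 : ℝ) < n := by positivity
          exact mul_ne_zero hx (Real.rpow_pos_of_pos hn0 _).ne'
      refine ((hlim.comp h1).mul_const (x ^ (2 * r))).congr' ?_
      filter_upwards [eventually_ne_atTop 0, h1.eventually self_mem_nhdsWithin] with n hn hz
      simp only [Function.comp_apply]
      have hz : x * (n : ℝ) ^ (-(1 / (2 * (r : ℝ)))) ≠ 0 := hz
      rw [← hscale n hn x]
      generalize x * (n : ℝ) ^ (-(1 / (2 * (r : ℝ)))) = z at *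
      field_simp
    refine Tendsto.const_mul _ ?_
    exact (Complex.continuous_ofReal.tendsto _).comp
      ((Real.continuous_exp.tendsto _).comp key.neg)

/-- Limit of the characteristic functions of `S_n / n^{1 - 1/(2r)}`, where `E` is the limit of the
characteristic functions of the smoothing Gaussian variables. -/
theorem tendsto_charFun_scaledSpinLaw {β K : ℝ} (hβ : 0 < β) (hK : 0 < K)
    (hE : macrostates β K = {0}) {r : ℕ} (h : HasMinType (G β K) 0 r) (s : ℝ) {E : ℂ}
    (hE0 : E ≠ 0)
    (hlim : Tendsto (fun n : ℕ => Complex.exp (-s ^ 2 /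
      (4 * (β * K * (n : ℝ) ^ (2 * (1 - 1 / (2 * (r : ℝ))) - 1) : ℝ)))) atTop (𝓝 E)) :
    Tendsto (fun n => charFun (scaledSpinLaw β K (1 - 1 / (2 * (r : ℝ))) n : Measure ℝ) s) atTop
      (𝓝 ((∫ x : ℝ, Complex.exp (s * x * Complex.I) *
          (Real.exp (-(iteratedDeriv (2 * r) (G β K) 0 / ((2 * r)! : ℝ) * x ^ (2 * r))) : ℝ)) /
        ((∫ x : ℝ, Real.exp (-(iteratedDeriv (2 * r) (G β K) 0 / ((2 * r)! : ℝ) * x ^ (2 * r)))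
          : ℝ) * E))) := by
  have hL : 0 < iteratedDeriv (2 * r) (G β K) 0 / ((2 * r)! : ℝ) := div_pos h.2.1 (by positivity)
  have hr := h.1
  have ht := h.tendsto_div_pow
  simp only [G_zero, sub_zero] at ht
  generalize iteratedDeriv (2 * r) (G β K) 0 / ((2 * r)! : ℝ) = L at *
  have hc : Continuous (G β K) := (contDiff_G β K (m := 0)).continuous
  obtain ⟨δ, hδ, hb⟩ := exists_mul_min_le hc (G_zero β K) (by omega)
    (fun x hx => G_pos_of_macrostates hβ hK hE hx) hL ht (even_two_mul r)
    (by positivity : 0 < β * K / 2) (fun x hx => G_ge_of_abs_ge hβ hK hx)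
  have hI := tendsto_integral_cexp_mul_exp_neg hc (G_zero β K) hr hδ hb ht
  have hI0 := hI 0
  simp only [Complex.ofReal_zero, zero_mul, Complex.exp_zero, one_mul] at hI0
  simp only [integral_complex_ofReal] at hI0
  have hpos : ((∫ x : ℝ, Real.exp (-(L * x ^ (2 * r))) : ℝ) : ℂ) ≠ 0 := by
    exact_mod_cast (integral_exp_pos (integrable_exp_neg_mul_pow hL hr)).ne'
  refine ((hI s).div (hI0.mul hlim) (mul_ne_zero hpos hE0)).congr' ?_
  filter_upwards [eventually_ne_atTop 0, hI0.eventually_ne hpos] with n hn hn'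
  have hid := integral_cexp_mul_exp_neg_G hβ hK (1 - 1 / (2 * (r : ℝ))) hn s
  rw [show 1 - 1 / (2 * (r : ℝ)) - 1 = -(1 / (2 * (r : ℝ))) by ring] at hid
  rw [Pi.div_apply, hid]
  exact (mul_div_mul_left _ _ hn').trans (mul_div_cancel_right₀ _ (Complex.exp_ne_zero _))

theorem convergesToDensity_scaledSpinLaw {β K : ℝ} (hβ : 0 < β) (hK : 0 < K)
    (hE : macrostates β K = {0}) {r : ℕ} (hr : 2 ≤ r) (h : HasMinType (G β K) 0 r) :
    ConvergesToDensity (scaledSpinLaw β K (1 - 1 / (2 * (r : ℝ)))) fun x =>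
      Real.exp (-(iteratedDeriv (2 * r) (G β K) 0 * x ^ (2 * r) / ((2 * r)! : ℝ))) := by
  have hL : 0 < iteratedDeriv (2 * r) (G β K) 0 / ((2 * r)! : ℝ) := div_pos h.2.1 (by positivity)
  have hint := integrable_exp_neg_mul_pow hL h.1
  have hZ := integral_exp_pos hint
  refine ⟨⟨volume.tilted fun x =>
      -(iteratedDeriv (2 * r) (G β K) 0 / ((2 * r)! : ℝ) * x ^ (2 * r)),
    isProbabilityMeasure_tilted hint⟩,
    ⟨(∫ x, Real.exp (-(iteratedDeriv (2 * r) (G β K) 0 / ((2 * r)! : ℝ) * x ^ (2 * r))))⁻¹,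
      inv_pos.2 hZ, ?_⟩, ?_⟩
  · rw [ProbabilityMeasure.coe_mk, Measure.tilted]
    congr 1
    ext x
    rw [div_eq_inv_mul, div_mul_eq_mul_div]
  · refine ProbabilityMeasure.tendsto_iff_tendsto_charFun.2 fun s => ?_
    -- The exponent of `n` is `1 - 1/r > 0`, so the smoothing disappears in the limit.
    have hlim : Tendsto (fun n : ℕ => Complex.exp (-s ^ 2 /
        (4 * (β * K * (n : ℝ) ^ (2 * (1 - 1 / (2 * (r : ℝ))) - 1) : ℝ)))) atTop (𝓝 1) := by
      have hr0 : (2 : ℝ) ≤ r := by exact_mod_cast hr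
      have he : 0 < 2 * (1 - 1 / (2 * (r : ℝ))) - 1 := by
        have : 1 / (2 * (r : ℝ)) < 1 / 2 := by
          apply one_div_lt_one_div_of_lt <;> linarith
        linarith
      have h1 : Tendsto (fun n : ℕ => β * K * (n : ℝ) ^ (2 * (1 - 1 / (2 * (r : ℝ))) - 1))
          atTop atTop :=
        ((tendsto_rpow_atTop he).comp tendsto_natCast_atTop_atTop).const_mul_atTop
          (mul_pos hβ hK)
      have h2 := (h1.const_mul_atTop (by norm_num : (0 : ℝ) < 4)).const_div_atTop (-s ^ 2)
      have h3 := (Complex.continuous_exp.tendsto _).comp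
        ((Complex.continuous_ofReal.tendsto _).comp h2)
      rw [Complex.ofReal_zero, Complex.exp_zero] at h3
      refine h3.congr fun n => ?_
      simp
    have hmain := tendsto_charFun_scaledSpinLaw hβ hK hE h s one_ne_zero hlim
    convert hmain using 2
    rw [mul_one, charFun_apply_real, ProbabilityMeasure.coe_mk, integral_tilted, ← integral_div]
    refine integral_congr_ae (.of_forall fun x => ?_)
    simp only [Complex.real_smul, Complex.ofReal_div]
    ring

/-- For `r = 1` the power of `n` in the smoothing variance is `0`, so its factor `exp(-s²/(4βK))`
persists and is divided out of `exp(-s²/(2G''(0)))`. -/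
theorem tendsto_scaledSpinLaw_gaussianReal {β K : ℝ} (hβ : 0 < β) (hK : 0 < K)
    (hE : macrostates β K = {0}) (h : HasMinType (G β K) 0 1) :
    0 < sigmaSq β K ∧ Tendsto (scaledSpinLaw β K (1 - 1 / (2 * ((1 : ℕ) : ℝ)))) atTop
      (𝓝 (⟨gaussianReal 0 (sigmaSq β K).toNNReal, inferInstance⟩ : ProbabilityMeasure ℝ)) := by
  have hD : 0 < iteratedDeriv 2 (G β K) 0 := h.2.1
  have hc := iteratedDeriv_two_cumulant_zero_pos β
  have hσ : 0 < sigmaSq β K := div_pos (by positivity) hD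
  refine ⟨hσ, ProbabilityMeasure.tendsto_iff_tendsto_charFun.2 fun s => ?_⟩
  have hmain := tendsto_charFun_scaledSpinLaw hβ hK hE h s
    (E := Complex.exp (-s ^ 2 / (4 * (β * K : ℝ)))) (Complex.exp_ne_zero _) (by norm_num)
  convert hmain using 2
  rw [ProbabilityMeasure.coe_mk, charFun_gaussianReal, Real.coe_toNNReal _ hσ.le]
  have hL : 0 < iteratedDeriv (2 * 1) (G β K) 0 / ((2 * 1)! : ℝ) := div_pos hD (by positivity)
  have hs := integral_cexp_mul_exp_neg_sq hL s 0
  have h0 := integral_cexp_mul_exp_neg_sq hL 0 0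
  have hZ : ((∫ x : ℝ, Real.exp
      (-(iteratedDeriv (2 * 1) (G β K) 0 / ((2 * 1)! : ℝ) * x ^ (2 * 1))) : ℝ) : ℂ) ≠ 0 := by
    exact_mod_cast (integral_exp_pos (integrable_exp_neg_mul_pow hL h.1)).ne'
  simp only [sub_zero, Complex.ofReal_zero, mul_zero, zero_mul, Complex.exp_zero, one_mul,
    ne_eq, OfNat.ofNat_ne_zero, not_false_eq_true, zero_pow, neg_zero, zero_div, mul_one,
    integral_complex_ofReal, neg_mul] at hs h0 hZ ⊢
  rw [hs, h0] at *
  rw [mul_div_mul_left _ _ hZ, ← Complex.exp_sub]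
  congr 1
  have hD2 := iteratedDeriv_two_G_zero β K
  rw [sigmaSq]
  generalize iteratedDeriv 2 (G β K) 0 = D at *
  generalize iteratedDeriv 2 (cumulant β) 0 = c at *
  have hDc : (D : ℂ) ≠ 0 := by exact_mod_cast hD.ne'
  have hβc : (β : ℂ) ≠ 0 := by exact_mod_cast hβ.ne'
  have hKc : (K : ℂ) ≠ 0 := by exact_mod_cast hK.ne'
  have hD2' : (D : ℂ) = 2 * β * K * (1 - 2 * β * K * c) := by rw [hD2]; push_cast; ring
  push_cast [Nat.factorial]
  field_simp
  linear_combination (-s ^ 2 : ℂ) * hD2'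

/-! ### Classification of the minimum point `0` -/

theorem eq_KCrit_iff {β K : ℝ} (hβ : 0 < β) (hK : 0 < K) :
    K = KCrit β ↔ iteratedDeriv 2 (G β K) 0 = 0 := by
  have hc := iteratedDeriv_two_cumulant_zero_pos β
  rw [iteratedDeriv_two_G_zero, KCrit, eq_div_iff (by positivity), mul_eq_zero,
    or_iff_right (by positivity : 2 * β * K ≠ 0), sub_eq_zero, eq_comm]
  constructor <;> intro h <;> linarith

theorem lt_betaCrit_iff (β : ℝ) : β < betaCrit ↔ 1 / 4 < Real.exp (-β) := by
  rw [betaCrit, Real.lt_log_iff_exp_lt (by norm_num), Real.exp_neg, ← one_div,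
    one_div_lt_one_div (by norm_num) (Real.exp_pos β)]

theorem eq_betaCrit_iff (β : ℝ) : β = betaCrit ↔ Real.exp (-β) = 1 / 4 := by
  rw [betaCrit, Real.exp_neg, one_div, inv_inj]
  constructor
  · rintro rfl
    exact Real.exp_log (by norm_num)
  · intro h
    rw [← h, Real.log_exp]

theorem hasMinType_G {β K : ℝ} {r : ℕ} (hr : 1 ≤ r) (hpos : 0 < iteratedDeriv (2 * r) (G β K) 0)
    (h0 : ∀ j, 1 ≤ j → j < r → iteratedDeriv (2 * j) (G β K) 0 = 0) :
    HasMinType (G β K) 0 r :=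
  ⟨hr, hpos, isBigO_sub_taylor_of_even (G_neg β K) hr (contDiff_G β K) h0⟩

theorem exists_hasMinType_G {β K : ℝ} (hβ : 0 < β) (hK : 0 < K) (hE : macrostates β K = {0}) :
    ∃ r, HasMinType (G β K) 0 r ∧ ((r = 1 ∧ K ≠ KCrit β) ∨
      (r = 2 ∧ K = KCrit β ∧ β < betaCrit) ∨ (r = 3 ∧ K = KCrit β ∧ β = betaCrit)) := by
  have hmin : ∀ x, G β K 0 ≤ G β K x := by
    intro x
    rw [G_zero]
    by_cases hx : x = 0
    · rw [hx, G_zero]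
    · exact (G_pos_of_macrostates hβ hK hE hx).le
  have hD2 : 0 ≤ iteratedDeriv 2 (G β K) 0 :=
    iteratedDeriv_nonneg_of_even_of_min (r := 1) (G_neg β K) le_rfl (contDiff_G β K)
      (fun j h1 h2 => by omega) hmin
  rcases hD2.lt_or_eq with hlt | heq
  · exact ⟨1, hasMinType_G le_rfl hlt (fun j h1 h2 => by omega),
      .inl ⟨rfl, fun h => hlt.ne' ((eq_KCrit_iff hβ hK).1 h)⟩⟩
  have hKc := (eq_KCrit_iff hβ hK).2 heq.symm
  have h2 : ∀ j, 1 ≤ j → j < 2 → iteratedDeriv (2 * j) (G β K) 0 = 0 := by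
    intro j hj1 hj2
    obtain rfl : j = 1 := by omega
    exact heq.symm
  have hD4 : 0 ≤ iteratedDeriv 4 (G β K) 0 :=
    iteratedDeriv_nonneg_of_even_of_min (r := 2) (G_neg β K) (by norm_num) (contDiff_G β K)
      h2 hmin
  have hD4eq : iteratedDeriv 4 (G β K) 0 = (2 * β * K) ^ 4 * (2 * Real.exp (-β)) /
      (1 + 2 * Real.exp (-β)) ^ 2 * (4 * Real.exp (-β) - 1) := by
    rw [iteratedDeriv_G_zero β K (by norm_num), iteratedDeriv_four_cumulant_zero]
    ring
  have hq : 0 < (2 * β * K) ^ 4 * (2 * Real.exp (-β)) / (1 + 2 * Real.exp (-β)) ^ 2 := by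
    positivity
  rcases hD4.lt_or_eq with hlt | heq4
  · refine ⟨2, hasMinType_G (by norm_num) hlt h2, .inr (.inl ⟨rfl, hKc, ?_⟩)⟩
    rw [lt_betaCrit_iff]
    rw [hD4eq] at hlt
    linarith [(pos_iff_pos_of_mul_pos hlt).1 hq]
  · have ha : Real.exp (-β) = 1 / 4 := by
      rw [hD4eq] at heq4
      rcases mul_eq_zero.1 heq4.symm with h | h
      · exact absurd h hq.ne'
      · linarith
    have h3 : ∀ j, 1 ≤ j → j < 3 → iteratedDeriv (2 * j) (G β K) 0 = 0 := by
      intro j hj1 hj2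
      obtain rfl | rfl : j = 1 ∨ j = 2 := by omega
      · exact heq.symm
      · exact heq4.symm
    refine ⟨3, hasMinType_G (by norm_num) ?_ h3, .inr (.inr ⟨rfl, hKc, (eq_betaCrit_iff β).2 ha⟩)⟩
    rw [iteratedDeriv_G_zero β K (by norm_num), iteratedDeriv_six_cumulant_zero_of_exp ha]
    rw [mul_neg, neg_neg]
    positivity

end BEG

end

theorem mainTheorem10 (β K : ℝ) (hβ : 0 < β) (hK : 0 < K)
    (hE : BEG.macrostates β K = {0}) :
    (∃! r : ℕ, BEG.HasMinType (BEG.G β K) 0 r) ∧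
    ∀ r : ℕ, BEG.HasMinType (BEG.G β K) 0 r →
      (r = 1 ∨ r = 2 ∨ r = 3) ∧
      (r = 1 → 0 < BEG.sigmaSq β K ∧
        Tendsto (BEG.scaledSpinLaw β K (1 - 1 / (2 * (r : ℝ)))) atTop
          (𝓝 (⟨gaussianReal 0 (BEG.sigmaSq β K).toNNReal, inferInstance⟩ :
            ProbabilityMeasure ℝ))) ∧
      ((r = 2 ∨ r = 3) →
        BEG.ConvergesToDensity (BEG.scaledSpinLaw β K (1 - 1 / (2 * (r : ℝ))))
          fun x => Real.exp
            (-(iteratedDeriv (2 * r) (BEG.G β K) 0 * x ^ (2 * r) / ((2 * r)! : ℝ)))) ∧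
      (r = 2 ↔ K = BEG.KCrit β ∧ β < BEG.betaCrit) ∧
      (r = 3 ↔ K = BEG.KCrit β ∧ β = BEG.betaCrit) ∧
      (r = 2 →
        iteratedDeriv 4 (BEG.G β K) 0 = -(2 * β * K) ^ 4 * iteratedDeriv 4 (BEG.cumulant β) 0 ∧
        iteratedDeriv 4 (BEG.G β K) 0 = -(2 * β * K) ^ 4 *
          (2 * Real.exp (-β) * (1 + 2 * Real.exp (-β)) *
              (1 - 2 * Real.exp (-β) - 8 * Real.exp (-(2 * β))) /
            (1 + 2 * Real.exp (-β)) ^ 4)) ∧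
      (r = 3 → iteratedDeriv 6 (BEG.G β K) 0 = 2 * (2 * β * K) ^ 6 / 9) := by
  obtain ⟨r₀, h₀, hcase⟩ := BEG.exists_hasMinType_G hβ hK hE
  have huniq : ∀ r, BEG.HasMinType (BEG.G β K) 0 r → r = r₀ :=
    fun r h => le_antisymm (h₀.le h) (h.le h₀)
  refine ⟨⟨r₀, h₀, huniq⟩, fun r h => ?_⟩
  obtain rfl := huniq r h
  refine ⟨?_, ?_, ?_, ?_, ?_, fun _ => ?_, ?_⟩
  · omega
  · rintro rfl
    exact BEG.tendsto_scaledSpinLaw_gaussianReal hβ hK hE h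
  · intro hr
    exact BEG.convergesToDensity_scaledSpinLaw hβ hK hE (by omega) h
  · rcases hcase with ⟨rfl, h1⟩ | ⟨rfl, h1, h2⟩ | ⟨rfl, h1, h2⟩
    · simp [h1]
    · simp [h1, h2]
    · simp [h2]
  · rcases hcase with ⟨rfl, h1⟩ | ⟨rfl, h1, h2⟩ | ⟨rfl, h1, h2⟩
    · simp [h1]
    · simp [h2.ne]
    · simp [h1, h2]
  · have h4 := BEG.iteratedDeriv_G_zero β K (k := 4) (by norm_num)
    refine ⟨by rw [h4, neg_mul], ?_⟩
    -- With `a = e^(-β)`, `1 - 2a - 8a² = (1 + 2a)(1 - 4a)` reconciles the two forms.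
    rw [h4, BEG.iteratedDeriv_four_cumulant_zero,
      show -(2 * β) = -β + -β by ring, Real.exp_add]
    have := Real.exp_pos (-β)
    field_simp
    ring
  · rintro rfl
    have hβc : β = BEG.betaCrit := by
      obtain ⟨h1, -⟩ | ⟨h1, -⟩ | ⟨-, -, h1⟩ := hcase
      · omega
      · omega
      · exact h1
    have ha := (BEG.eq_betaCrit_iff β).1 hβc
    rw [BEG.iteratedDeriv_G_zero β K (by norm_num), BEG.iteratedDeriv_six_cumulant_zero_of_exp ha]
    ring
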